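/- Let $\mathcal A$ be an abelian length category, i.e. an abelian category in which every object has a finite composition series and whose isomorphism classes of objects form a set. A length function on $\mathcal A$ is a map $\ell$ assigning to each object $X$ a real number $\ell(X)\ge 0$ such that $\ell(X)=0$ if and only if $X=0$, and $\ell(X)=\ell(X')+\ell(X'')$ for every short exact sequence $0\to X'\to X\to X''\to 0$. Let $\operatorname{ind}\mathcal A$ be the set of isomorphism classes of indecomposable objects of $\mathcal A$, partially ordered by $X\subseteq Y$ if and only if there is a monomorphism $X\to Y$. Let $\operatorname{Ch}(\mathbb R)$ be the set of finite subsets of $\mathbb R$ with the (total) lexicographic order $$A\le B\quad:\Longleftrightarrow\quad \min(B\setminus A)\le\min(A\setminus B),\qquad\text{where }\min\emptyset:=+\infty .$$ The Gabriel–Roiter measure with respect to $\ell$ is the map $\ell^*\colon\operatorname{ind}\mathcal A\to\operatorname{Ch}(\mathbb R)$, $$\ell^*(X)=\max\{\ell(\mathcal X)\mid \mathcal X\text{ a finite chain in }\operatorname{ind}\mathcal A\text{ with }\max\mathcal X=X\},\qquad \ell(\mathcal X)=\{\ell(X')\mid X'\in\mathcal X\}.$$ **Theorem.** An indecomposable object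 $Q$ of $\mathcal A$ is injective if and only if there is a length function $\ell$ on $\mathcal A$ such that $\ell^*(X)\le\ell^*(Q)$ for all $X\in\operatorname{ind}\mathcal A$. -/

import Mathlib

open CategoryTheory CategoryTheory.Limits

universe v u w w'

namespace GabrielRoiter

noncomputable section

/-! ### Finite chains and the lexicographic order -/

/-- `Ch S`: the finite chains in a partially ordered set `S`. -/
@[ext]
structure Ch (S : Type w) [PartialOrder S] where
  carrier : Finset S
  isChain : IsChain (· ≤ ·) (carrier : Set S)

namespace Ch

/-- The image of a finite chain under a monotone map. -/
def map {S : Type w} {T : Type w'} [PartialOrder S] [LinearOrder T] (f : S → T)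
    (hf : Monotone f) (X : Ch S) : Ch T where
  carrier := X.carrier.image f
  isChain := by
    intro a ha b hb _
    simp only [Finset.coe_image, Set.mem_image] at ha hb
    obtain ⟨x, hx, rfl⟩ := ha
    obtain ⟨y, hy, rfl⟩ := hb
    exact (X.isChain.total hx hy).imp (fun h => hf h) (fun h => hf h)

variable {T : Type w} [LinearOrder T]

/-- The lexicographic order on finite chains: `X ≤ Y` iff `min (Y \ X) ≤ min (X \ Y)`,
where `Finset.min` takes values in `WithTop T`, so that the minimum of the empty set is `⊤`. -/
instance : LE (Ch T) :=
  ⟨fun X Y => (Y.carrier \ X.carrier).min ≤ (X.carrier \ Y.carrier).min⟩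

theorem le_def {X Y : Ch T} :
    X ≤ Y ↔ (Y.carrier \ X.carrier).min ≤ (X.carrier \ Y.carrier).min := Iff.rfl

/-- Comparison with the colexicographic order over the opposite order of `T`. -/
def toColexDual (X : Ch T) : Colex (Finset Tᵒᵈ) :=
  toColex (X.carrier.map OrderDual.toDual.toEmbedding)

theorem toColexDual_injective : Function.Injective (toColexDual (T := T)) := by
  intro X Y h
  apply Ch.ext
  have h' := toColex.injective h
  exact Finset.map_injective _ h'

theorem le_iff_toColexDual {X Y : Ch T} : X ≤ Y ↔ toColexDual X ≤ toColexDual Y := by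
  rw [le_def, toColexDual, toColexDual, Finset.Colex.toColex_le_toColex]
  simp only [Finset.le_min_iff, Finset.mem_sdiff, Finset.mem_map_equiv]
  constructor
  · intro h a ha ha'
    have h1 := h (OrderDual.ofDual a) ⟨ha, ha'⟩
    have hne : (Y.carrier \ X.carrier).Nonempty := by
      rw [Finset.nonempty_iff_ne_empty]
      intro h0
      rw [h0, Finset.min_empty] at h1
      exact absurd h1 (by simp)
    obtain ⟨b, hb⟩ := Finset.min_of_nonempty hne
    have hb' := Finset.mem_of_min hb
    rw [Finset.mem_sdiff] at hb'
    rw [hb] at h1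
    exact ⟨OrderDual.toDual b, hb'.1, hb'.2, OrderDual.le_toDual.2 (WithTop.coe_le_coe.1 h1)⟩
  · intro h x hx
    obtain ⟨b, hbY, hbX, hab⟩ := h (a := OrderDual.toDual x) hx.1 hx.2
    exact (Finset.min_le (Finset.mem_sdiff.2 ⟨hbY, hbX⟩)).trans (WithTop.coe_le_coe.2 hab)

/-- The lexicographic order on `Ch T` is total if `T` is. -/
instance : LinearOrder (Ch T) where
  le_refl X := le_iff_toColexDual.2 le_rfl
  le_trans X Y Z h h' :=
    le_iff_toColexDual.2 ((le_iff_toColexDual.1 h).trans (le_iff_toColexDual.1 h'))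
  le_antisymm X Y h h' :=
    toColexDual_injective (le_antisymm (le_iff_toColexDual.1 h) (le_iff_toColexDual.1 h'))
  le_total X Y := by
    rw [le_iff_toColexDual, le_iff_toColexDual]
    exact le_total _ _
  toDecidableLE := Classical.decRel _

end Ch

/-! ### Length functions on partially ordered sets -/

/-- A length function on a partially ordered set `S`, with values in a totally ordered set `T`
(so that any two of its values are comparable). -/
structure PosetLengthFunction (S : Type w) (T : Type w') [PartialOrder S] [LinearOrder T] where
  toFun : S → T
  strictMono' : ∀ x y : S, x < y → toFun x < toFun y
  finite' : ∀ x : S, {t : T | ∃ x' : S, x' ≤ x ∧ toFun x' = t}.Finite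

namespace PosetLengthFunction

variable {S : Type w} {T : Type w'} [PartialOrder S] [LinearOrder T]

theorem monotone (lam : PosetLengthFunction S T) : Monotone lam.toFun :=
  StrictMono.monotone fun x y h => lam.strictMono' x y h

/-- The set of all images `λ(X)`, where `X` is a finite chain in `S` with `max X = x`. -/
def chainImages (lam : PosetLengthFunction S T) (x : S) : Set (Ch T) :=
  {Z | ∃ X : Ch S, IsGreatest (X.carrier : Set S) x ∧ X.map lam.toFun lam.monotone = Z}

theorem chainImages_finite (lam : PosetLengthFunction S T) (x : S) :
    (lam.chainImages x).Finite := by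
  have h := ((lam.finite' x).toFinset.powerset.finite_toSet)
  refine Set.Finite.of_finite_image (f := Ch.carrier) (h.subset ?_) ?_
  · rintro _ ⟨_, ⟨X, hX, rfl⟩, rfl⟩
    simp only [Finset.coe_powerset, Set.mem_preimage, Set.mem_powerset_iff]
    intro t ht
    simp only [Ch.map, Finset.coe_image, Set.mem_image] at ht
    obtain ⟨y, hy, rfl⟩ := ht
    simp only [Set.Finite.coe_toFinset]
    exact ⟨y, hX.2 hy, rfl⟩
  · intro X _ Y _ hXY
    exact Ch.ext hXY

theorem chainImages_nonempty (lam : PosetLengthFunction S T) (x : S) :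
    (lam.chainImages x).Nonempty :=
  ⟨_, ⟨{x}, by simp⟩, by simp, rfl⟩

/-- The chain length function `λ*` induced by `λ`:
`λ*(x) = max {λ(X) | X a finite chain with max X = x}`. -/
def chainLength (lam : PosetLengthFunction S T) (x : S) : Ch T :=
  (lam.chainImages_finite x).toFinset.max'
    ((Set.Finite.toFinset_nonempty _).2 (lam.chainImages_nonempty x))

theorem isGreatest_chainLength (lam : PosetLengthFunction S T) (x : S) :
    IsGreatest (lam.chainImages x) (lam.chainLength x) := by
  have h := Finset.isGreatest_max' (lam.chainImages_finite x).toFinset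
    ((Set.Finite.toFinset_nonempty _).2 (lam.chainImages_nonempty x))
  rwa [Set.Finite.coe_toFinset] at h

end PosetLengthFunction

/-! ### Abelian length categories -/

variable {C : Type u} [Category.{v} C] [Abelian C]

/-- `X` has a finite composition series `0 = X₀ ⊆ X₁ ⊆ … ⊆ Xₙ = X`,
that is, each `Xᵢ₊₁ / Xᵢ` is simple. -/
def HasFiniteLength (X : C) : Prop :=
  ∃ (n : ℕ) (F : Fin (n + 1) → Subobject X) (hF : Monotone F),
    F 0 = ⊥ ∧ F (Fin.last n) = ⊤ ∧
      ∀ i : Fin n, Simple (cokernel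
        (Subobject.ofLE (F i.castSucc) (F i.succ) (hF i.castSucc_le_succ)))

/-- An abelian category is a length category if all its objects have finite length.
(The objects form a type, so the isomorphism classes of objects always form a set here.) -/
class IsLengthCategory (C : Type u) [Category.{v} C] [Abelian C] : Prop where
  hasFiniteLength : ∀ X : C, HasFiniteLength X

/-- Auxiliary: `X` is obtained from a zero object by `n` successive extensions by simple
objects. -/
inductive SimpleFiltered : C → ℕ → Prop
  | zero (X : C) (hX : IsZero X) : SimpleFiltered X 0
  | step (X' X S : C) (n : ℕ) (f : X' ⟶ X) (g : X ⟶ S) (hfg : f ≫ g = 0)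
      (h : (ShortComplex.mk f g hfg).ShortExact) (hS : Simple S)
      (hX' : SimpleFiltered X' n) : SimpleFiltered X (n + 1)

theorem shortExact_cokernel {X Y : C} (f : X ⟶ Y) [Mono f] :
    (ShortComplex.mk f (cokernel.π f) (cokernel.condition f)).ShortExact where
  exact := ShortComplex.exact_cokernel f
  mono_f := inferInstance
  epi_g := inferInstance

theorem shortExact_kernel {X Y : C} (f : X ⟶ Y) [Epi f] :
    (ShortComplex.mk (kernel.ι f) f (kernel.condition f)).ShortExact where
  exact := ShortComplex.exact_kernel f
  mono_f := inferInstance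
  epi_g := inferInstance

theorem SimpleFiltered.of_iso {X Y : C} (e : X ≅ Y) {n : ℕ} (h : SimpleFiltered X n) :
    SimpleFiltered Y n := by
  cases h with
  | zero _ hX => exact .zero _ (hX.of_iso e.symm)
  | step X' _ S n f g hfg h hS hX' =>
    refine .step X' Y S n (f ≫ e.hom) (e.inv ≫ g) (by simp [hfg]) ?_ hS hX'
    exact ShortComplex.shortExact_of_iso
      (S₁ := ShortComplex.mk f g hfg)
      (S₂ := ShortComplex.mk (f ≫ e.hom) (e.inv ≫ g) (by simp [hfg]))
      (ShortComplex.isoMk (Iso.refl _) e (Iso.refl _) (by simp) (by simp)) h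

theorem HasFiniteLength.simpleFiltered {X : C} (h : HasFiniteLength X) :
    ∃ n, SimpleFiltered X n := by
  obtain ⟨n, F, hF, h0, h1, hs⟩ := h
  have key : ∀ i : Fin (n + 1), ∃ m, SimpleFiltered ((F i : Subobject X) : C) m := by
    intro i
    induction i using Fin.induction with
    | zero =>
      refine ⟨0, .zero _ ?_⟩
      rw [h0]
      exact (isZero_zero C).of_iso Subobject.botCoeIsoZero
    | succ i ih =>
      obtain ⟨m, hm⟩ := ih
      exact ⟨m + 1, .step _ _ _ m _ _ _ (shortExact_cokernel _) (hs i) hm⟩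
  obtain ⟨m, hm⟩ := key (Fin.last n)
  rw [h1] at hm
  exact ⟨m, hm.of_iso (asIso (⊤ : Subobject X).arrow)⟩

/-- The subobject `kernel (i ≫ g)` of `A`, seen as a subobject of `X'`. -/
def restrictKernel {X' X S A : C} {f : X' ⟶ X} {g : X ⟶ S} {hfg : f ≫ g = 0}
    (h : (ShortComplex.mk f g hfg).ShortExact) (i : A ⟶ X) : kernel (i ≫ g) ⟶ X' :=
  haveI := h.mono_f
  h.exact.lift (kernel.ι (i ≫ g) ≫ i) (by simp)

theorem restrictKernel_comp {X' X S A : C} {f : X' ⟶ X} {g : X ⟶ S} {hfg : f ≫ g = 0}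
    (h : (ShortComplex.mk f g hfg).ShortExact) (i : A ⟶ X) :
    restrictKernel h i ≫ f = kernel.ι (i ≫ g) ≫ i :=
  have := h.mono_f
  h.exact.lift_f _ _

theorem mono_restrictKernel {X' X S A : C} {f : X' ⟶ X} {g : X ⟶ S} {hfg : f ≫ g = 0}
    (h : (ShortComplex.mk f g hfg).ShortExact) (i : A ⟶ X) [Mono i] :
    Mono (restrictKernel h i) := by
  have : Mono (restrictKernel h i ≫ f) := by
    rw [restrictKernel_comp]
    infer_instance
  exact mono_of_mono _ f

theorem SimpleFiltered.isIso_or {X : C} {n : ℕ} (h : SimpleFiltered X n) :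
    ∀ {A : C} (i : A ⟶ X) [Mono i], IsIso i ∨ ∃ m < n, SimpleFiltered A m := by
  induction h with
  | zero X hX =>
    intro A i _
    left
    have hA : IsZero A := IsZero.of_mono i hX
    exact ⟨0, hA.eq_of_src _ _, hX.eq_of_src _ _⟩
  | step X' X S n f g hfg h hS hX' ih =>
    intro A i _
    have := h.mono_f
    have := mono_restrictKernel h i
    have hK : ∃ m ≤ n, SimpleFiltered (kernel (i ≫ g)) m := by
      rcases ih (restrictKernel h i) with hiso | ⟨m, hm, hm'⟩
      · exact ⟨n, le_rfl, hX'.of_iso (asIso (restrictKernel h i)).symm⟩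
      · exact ⟨m, hm.le, hm'⟩
    by_cases hz : i ≫ g = 0
    · right
      obtain ⟨m, hm, hm'⟩ := hK
      have : IsIso (kernel.ι (i ≫ g)) := equalizer.ι_of_eq hz
      exact ⟨m, by omega, hm'.of_iso (asIso (kernel.ι (i ≫ g)))⟩
    · have : Epi (i ≫ g) := epi_of_nonzero_to_simple hz
      rcases ih (restrictKernel h i) with hiso | ⟨m, hm, hm'⟩
      · left
        let φ : ShortComplex.mk (kernel.ι (i ≫ g)) (i ≫ g) (kernel.condition _) ⟶
            ShortComplex.mk f g hfg :=
          { τ₁ := restrictKernel h i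
            τ₂ := i
            τ₃ := 𝟙 S
            comm₁₂ := restrictKernel_comp h i
            comm₂₃ := by simp }
        exact ShortComplex.isIso₂_of_shortExact_of_isIso₁₃' φ
          (shortExact_kernel (i ≫ g)) h hiso (inferInstanceAs (IsIso (𝟙 S)))
      · right
        exact ⟨m + 1, by omega, .step _ _ _ m _ _ _ (shortExact_kernel (i ≫ g)) hS hm'⟩

theorem isIso_of_mono_endo [IsLengthCategory C] {X : C} (f : X ⟶ X) [Mono f] : IsIso f := by
  classical
  have h := (IsLengthCategory.hasFiniteLength X).simpleFiltered
  rcases (Nat.find_spec h).isIso_or f with h1 | ⟨m, hm, hm'⟩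
  · exact h1
  · exact absurd hm' (Nat.find_min h hm)

/-! ### The poset of isomorphism classes of indecomposable objects -/

variable (C) in
/-- Isomorphism of indecomposable objects. -/
def indSetoid : Setoid {X : C // Indecomposable X} where
  r X Y := Nonempty (X.1 ≅ Y.1)
  iseqv := ⟨fun X => ⟨Iso.refl X.1⟩, fun ⟨e⟩ => ⟨e.symm⟩, fun ⟨e⟩ ⟨e'⟩ => ⟨e ≪≫ e'⟩⟩

variable (C) in
/-- The set of isomorphism classes of indecomposable objects of `C`. -/
def Ind : Type u := Quotient (indSetoid C)

namespace Ind

/-- The isomorphism class of an indecomposable object. -/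
def mk (X : C) (hX : Indecomposable X) : Ind C := Quotient.mk (indSetoid C) ⟨X, hX⟩

/-- The subobject relation: `[X] ≤ [Y]` iff there is a monomorphism `X ⟶ Y`. -/
instance : LE (Ind C) where
  le := Quotient.lift₂ (s₁ := indSetoid C) (s₂ := indSetoid C)
    (fun X Y => ∃ f : X.1 ⟶ Y.1, Mono f) (by
      rintro X Y X' Y' ⟨e⟩ ⟨e'⟩
      apply propext
      constructor
      · rintro ⟨f, hf⟩
        exact ⟨e.inv ≫ f ≫ e'.hom, inferInstance⟩
      · rintro ⟨f, hf⟩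
        exact ⟨e.hom ≫ f ≫ e'.inv, inferInstance⟩)

theorem mk_le_mk {X Y : C} {hX : Indecomposable X} {hY : Indecomposable Y} :
    mk X hX ≤ mk Y hY ↔ ∃ f : X ⟶ Y, Mono f := Iff.rfl

theorem mk_eq_mk {X Y : C} {hX : Indecomposable X} {hY : Indecomposable Y} :
    mk X hX = mk Y hY ↔ Nonempty (X ≅ Y) := Quotient.eq (r := indSetoid C)

theorem exists_mk (x : Ind C) : ∃ (X : C) (hX : Indecomposable X), x = mk X hX := by
  obtain ⟨⟨X, hX⟩, rfl⟩ := Quotient.exists_rep x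
  exact ⟨X, hX, rfl⟩

instance [IsLengthCategory C] : PartialOrder (Ind C) where
  le_refl x := by
    obtain ⟨X, hX, rfl⟩ := exists_mk x
    exact mk_le_mk.2 ⟨𝟙 X, inferInstance⟩
  le_trans x y z := by
    obtain ⟨X, hX, rfl⟩ := exists_mk x
    obtain ⟨Y, hY, rfl⟩ := exists_mk y
    obtain ⟨Z, hZ, rfl⟩ := exists_mk z
    rintro ⟨f, hf⟩ ⟨g, hg⟩
    exact mk_le_mk.2 ⟨f ≫ g, mono_comp f g⟩
  le_antisymm x y := by
    obtain ⟨X, hX, rfl⟩ := exists_mk x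
    obtain ⟨Y, hY, rfl⟩ := exists_mk y
    rintro ⟨f, hf⟩ ⟨g, hg⟩
    have : Mono f := hf
    have : Mono g := hg
    have : IsIso (g ≫ f) := isIso_of_mono_endo (g ≫ f)
    have : IsSplitEpi f := IsSplitEpi.mk' ⟨inv (g ≫ f) ≫ g, by simp⟩
    have : IsIso f := isIso_of_mono_of_isSplitEpi f
    exact mk_eq_mk.2 ⟨asIso f⟩

end Ind

/-! ### Length functions on abelian categories and the Gabriel–Roiter measure -/

/-- A length function on an abelian category: a map `ℓ` from objects to nonnegative reals, zero
exactly on zero objects and additive on short exact sequences `0 ⟶ X₁ ⟶ X₂ ⟶ X₃ ⟶ 0`. -/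
structure LengthFunction (C : Type u) [Category.{v} C] [Abelian C] where
  toFun : C → ℝ
  nonneg : ∀ X : C, 0 ≤ toFun X
  eq_zero_iff : ∀ X : C, toFun X = 0 ↔ IsZero X
  additive : ∀ E : ShortComplex C, E.ShortExact → toFun E.X₂ = toFun E.X₁ + toFun E.X₃

namespace LengthFunction

variable (ℓ : LengthFunction C)

theorem eq_of_isZero_cokernel {X Y : C} (f : X ⟶ Y) [Mono f] (h : IsZero (cokernel f)) :
    ℓ.toFun X = ℓ.toFun Y := by
  have h1 := ℓ.additive _ (shortExact_cokernel f)
  have h2 := (ℓ.eq_zero_iff _).2 h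
  simp only at h1
  linarith

theorem eq_of_iso {X Y : C} (e : X ≅ Y) : ℓ.toFun X = ℓ.toFun Y :=
  ℓ.eq_of_isZero_cokernel e.hom (isZero_cokernel_of_epi e.hom)

theorem finite_values {X : C} {n : ℕ} (h : SimpleFiltered X n) :
    {t : ℝ | ∃ (A : C) (i : A ⟶ X), Mono i ∧ ℓ.toFun A = t}.Finite := by
  induction h with
  | zero X hX =>
    refine (Set.finite_singleton (0 : ℝ)).subset ?_
    rintro _ ⟨A, i, hi, rfl⟩
    exact (ℓ.eq_zero_iff A).2 (IsZero.of_mono i hX)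
  | step X' X S n f g hfg h hS hX' ih =>
    refine (ih.union (ih.image (fun t => t + ℓ.toFun S))).subset ?_
    rintro _ ⟨A, i, hi, rfl⟩
    have hm := mono_restrictKernel h i
    by_cases hz : i ≫ g = 0
    · left
      have : IsIso (kernel.ι (i ≫ g)) := equalizer.ι_of_eq hz
      exact ⟨_, restrictKernel h i, hm, ℓ.eq_of_iso (asIso (kernel.ι (i ≫ g)))⟩
    · right
      have : Epi (i ≫ g) := epi_of_nonzero_to_simple hz
      exact ⟨_, ⟨_, restrictKernel h i, hm, rfl⟩, (ℓ.additive _ (shortExact_kernel (i ≫ g))).symm⟩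

/-- The length function on the poset `Ind C` induced by a length function on `C`. -/
def onInd [IsLengthCategory C] : PosetLengthFunction (Ind C) ℝ where
  toFun := Quotient.lift (s := indSetoid C) (fun X => ℓ.toFun X.1)
    (fun _ _ ⟨e⟩ => ℓ.eq_of_iso e)
  strictMono' x y := by
    obtain ⟨X, hX, rfl⟩ := Ind.exists_mk x
    obtain ⟨Y, hY, rfl⟩ := Ind.exists_mk y
    intro hlt
    obtain ⟨f, hf⟩ := Ind.mk_le_mk.1 hlt.le
    change ℓ.toFun X < ℓ.toFun Y
    have h1 := ℓ.additive _ (shortExact_cokernel f)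
    simp only at h1
    have h2 := ℓ.nonneg (cokernel f)
    have h3 : ℓ.toFun (cokernel f) ≠ 0 := by
      intro h0
      have hz : cokernel.π f = 0 := ((ℓ.eq_zero_iff _).1 h0).eq_of_tgt _ _
      have : Epi f := Preadditive.epi_of_cokernel_zero hz
      have : IsIso f := isIso_of_mono_of_epi f
      exact hlt.ne (Ind.mk_eq_mk.2 ⟨asIso f⟩)
    have h4 := lt_of_le_of_ne h2 h3.symm
    linarith
  finite' x := by
    obtain ⟨X, hX, rfl⟩ := Ind.exists_mk x
    obtain ⟨n, hn⟩ := (IsLengthCategory.hasFiniteLength X).simpleFiltered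
    refine (ℓ.finite_values hn).subset ?_
    rintro _ ⟨y, hy, rfl⟩
    obtain ⟨Y, hY, rfl⟩ := Ind.exists_mk y
    obtain ⟨f, hf⟩ := Ind.mk_le_mk.1 hy
    exact ⟨Y, f, hf, rfl⟩

/-- The Gabriel–Roiter measure `ℓ* : Ind C → Ch ℝ` with respect to `ℓ`. -/
def gabrielRoiterMeasure [IsLengthCategory C] : Ind C → Ch ℝ :=
  ℓ.onInd.chainLength

end LengthFunction

end

end GabrielRoiter

/-! Let `Q` be injective and `S` a simple subobject. Choose weights making `S` strictly shorter than
every other nonzero object. In a chain that leaves the subobjects of `Q`, let X' be the last member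
embedding in `Q` and Y the next one. Injectivity extends X' → `Q` to Y → `Q`. The image of this map
is indecomposable, lies properly above X' and is shorter than Y; if there is no X', use `S` instead.
The chain that passes through this image and ends in `Q` has a measure at least as large. This is
`chainLength_le_of_interpolation` combined with `indecomposable_of_mono`, which rests on Fitting's
lemma.

The converse is Gabriel's main property, `mainProperty`: jointly monic morphisms from an
indecomposable object to indecomposables include an isomorphism or one whose target has larger
measure. If `Q` has maximal measure, only the isomorphism is possible. Applied to the composites of
a monomorphism `Q` → Y with morphisms from Y to indecomposables, it gives a retraction. So every
monomorphism out of `Q` splits, and pushouts give injectivity. -/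

namespace GabrielRoiter

/-! ### Chain lengths on an abstract poset -/

namespace Ch

variable {T : Type w} [LinearOrder T]

theorem le_iff_forall {X Y : Ch T} :
    X ≤ Y ↔ ∀ a ∈ X.carrier, a ∉ Y.carrier → ∃ b ∈ Y.carrier, b ∉ X.carrier ∧ b ≤ a := by
  rw [le_iff_toColexDual, toColexDual, toColexDual, Finset.Colex.toColex_le_toColex]
  simp only [Finset.mem_map_equiv]
  exact Iff.rfl

theorem lt_iff_exists {X Y : Ch T} :
    X < Y ↔ ∃ b ∈ Y.carrier, b ∉ X.carrier ∧ ∀ a ∈ X.carrier, a ∉ Y.carrier → b < a := by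
  rw [← not_le, le_iff_forall]
  push Not
  rfl

end Ch

namespace PosetLengthFunction

variable {S : Type w} {T : Type w'} [PartialOrder S] [LinearOrder T]
  (lam : PosetLengthFunction S T)

theorem strictMono : StrictMono lam.toFun := fun x y h => lam.strictMono' x y h

theorem map_le_chainLength {x : S} (X : Ch S) (hX : IsGreatest (X.carrier : Set S) x) :
    X.map lam.toFun lam.monotone ≤ lam.chainLength x :=
  (lam.isGreatest_chainLength x).2 ⟨X, hX, rfl⟩

theorem exists_map_eq_chainLength (x : S) :
    ∃ X : Ch S, IsGreatest (X.carrier : Set S) x ∧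
      X.map lam.toFun lam.monotone = lam.chainLength x :=
  (lam.isGreatest_chainLength x).1

theorem mem_map {X : Ch S} {t : T} :
    t ∈ (X.map lam.toFun lam.monotone).carrier ↔ ∃ x ∈ X.carrier, lam.toFun x = t := by
  simp [Ch.map]

theorem mem_chainLength_self (x : S) : lam.toFun x ∈ (lam.chainLength x).carrier := by
  obtain ⟨X, hX, h⟩ := lam.exists_map_eq_chainLength x
  rw [← h, mem_map]
  exact ⟨x, hX.1, rfl⟩

theorem le_of_mem_chainLength {x : S} {t : T} (ht : t ∈ (lam.chainLength x).carrier) :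
    t ≤ lam.toFun x := by
  obtain ⟨X, hX, h⟩ := lam.exists_map_eq_chainLength x
  rw [← h, mem_map] at ht
  obtain ⟨y, hy, rfl⟩ := ht
  exact lam.monotone (hX.2 hy)

/-- Appending `y` to a chain realizing `λ*(x)` adds a value above all others and removes none. -/
theorem chainLength_strictMono : StrictMono lam.chainLength := by
  classical
  intro x y hxy
  obtain ⟨X, hX, h⟩ := lam.exists_map_eq_chainLength x
  have hlt : ∀ a ∈ X.carrier, a < y := fun a ha => (hX.2 ha).trans_lt hxy
  let Y : Ch S := ⟨insert y X.carrier, by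
    rw [Finset.coe_insert]
    exact X.isChain.insert fun b hb _ => Or.inr (hlt b hb).le⟩
  have hY : IsGreatest (Y.carrier : Set S) y :=
    ⟨by simp [Y], fun a ha => by
      rcases Finset.mem_insert.1 ha with rfl | ha
      · exact le_rfl
      · exact (hlt a ha).le⟩
  refine lt_of_lt_of_le ?_ (lam.map_le_chainLength Y hY)
  rw [← h, Ch.lt_iff_exists]
  refine ⟨lam.toFun y, lam.mem_map.2 ⟨y, hY.1, rfl⟩, ?_, ?_⟩
  · rw [mem_map]
    rintro ⟨a, ha, hay⟩
    exact (lam.strictMono (hlt a ha)).ne hay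
  · intro t ht ht'
    obtain ⟨a, ha, rfl⟩ := lam.mem_map.1 ht
    exact absurd (lam.mem_map.2 ⟨a, Finset.mem_insert_of_mem ha, rfl⟩) ht'

/-- Either `x` is the only member of a chain realizing `λ*(x)`, or such a chain has a member
preceding `x`. -/
theorem chainLength_lt_of_or (x : S) :
    (∀ y, lam.toFun y < lam.toFun x → lam.chainLength x < lam.chainLength y) ∨
      ∃ x' < x, ∀ y, lam.toFun y < lam.toFun x → lam.chainLength x' < lam.chainLength y →
        lam.chainLength x < lam.chainLength y := by
  classical
  obtain ⟨X, hX, h⟩ := lam.exists_map_eq_chainLength x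
  rcases (X.carrier.erase x).eq_empty_or_nonempty with h0 | h0
  · left
    intro y hy
    rw [← h, Ch.lt_iff_exists]
    have hx : ∀ a ∈ X.carrier, a = x := fun a ha => by
      by_contra hne
      exact Finset.notMem_empty a (h0 ▸ Finset.mem_erase.2 ⟨hne, ha⟩)
    -- The chain is `{x}`, so the smaller value `λ(y)` decides the comparison.
    refine ⟨lam.toFun y, lam.mem_chainLength_self y, ?_, ?_⟩
    · rw [mem_map]
      rintro ⟨a, ha, hay⟩
      rw [hx a ha] at hay
      exact hy.ne' hay
    · intro t ht _
      obtain ⟨a, ha, rfl⟩ := lam.mem_map.1 ht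
      rwa [hx a ha]
  · right
    obtain ⟨x', hx', hmax⟩ := Finset.exists_maximal h0
    have hx'X := Finset.mem_erase.1 hx'
    refine ⟨x', lt_of_le_of_ne (hX.2 hx'X.2) hx'X.1, fun y hy hlt => ?_⟩
    let X' : Ch S := ⟨X.carrier.erase x, X.isChain.mono (by simp)⟩
    have hX' : IsGreatest (X'.carrier : Set S) x' := by
      refine ⟨hx', fun a ha => ?_⟩
      rcases X.isChain.total (Finset.mem_erase.1 ha).2 hx'X.2 with h1 | h1
      · exact h1
      · exact hmax ha h1
    obtain ⟨b, hb, hbX, hbl⟩ :=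
      Ch.lt_iff_exists.1 ((lam.map_le_chainLength X' hX').trans_lt hlt)
    -- The value `b` that decides against `X'` lies below `λ(x)`, so putting `x` back changes
    -- nothing.
    have hbx : b < lam.toFun x := (lam.le_of_mem_chainLength hb).trans_lt hy
    rw [← h, Ch.lt_iff_exists]
    refine ⟨b, hb, ?_, ?_⟩
    · rw [mem_map]
      rintro ⟨a, ha, rfl⟩
      by_cases hax : a = x
      · exact hbx.ne (by rw [hax])
      · exact hbX (lam.mem_map.2 ⟨a, Finset.mem_erase.2 ⟨hax, ha⟩, rfl⟩)
    · intro t ht ht'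
      obtain ⟨a, ha, rfl⟩ := lam.mem_map.1 ht
      by_cases hax : a = x
      · rwa [hax]
      · exact hbl _ (lam.mem_map.2 ⟨a, Finset.mem_erase.2 ⟨hax, ha⟩, rfl⟩) ht'

/-- A criterion for `q` to have the largest chain length. -/
theorem chainLength_le_of_interpolation {q s : S} (hs : s ≤ q)
    (hsx : ∀ x, ¬ x ≤ q → lam.toFun s < lam.toFun x)
    (hq : ∀ x, ¬ x ≤ q → ∀ x' < x, x' ≤ q →
      ∃ z, x' < z ∧ z ≤ q ∧ lam.toFun z < lam.toFun x) (x : S) :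
    lam.chainLength x ≤ lam.chainLength q := by
  classical
  by_cases hxq : x ≤ q
  · exact lam.chainLength_strictMono.monotone hxq
  obtain ⟨X, hX, h⟩ := lam.exists_map_eq_chainLength x
  obtain ⟨y, hy, hmin⟩ := Finset.exists_minimal (s := X.carrier.filter fun a => ¬ a ≤ q)
    ⟨x, Finset.mem_filter.2 ⟨hX.1, hxq⟩⟩
  obtain ⟨hyX, hyq⟩ := Finset.mem_filter.1 hy
  have hBy : ∀ a ∈ X.carrier, ¬ a ≤ q → y ≤ a := fun a ha haq => by
    rcases X.isChain.total hyX ha with h1 | h1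
    · exact h1
    · exact hmin (Finset.mem_filter.2 ⟨ha, haq⟩) h1
  have hAy : ∀ a ∈ X.carrier, a ≤ q → a < y := fun a ha haq => by
    rcases X.isChain.total ha hyX with h1 | h1
    · exact lt_of_le_of_ne h1 (fun h2 => hyq (h2 ▸ haq))
    · exact absurd (h1.trans haq) hyq
  -- `z` is to replace the part of the chain from `y` on.
  obtain ⟨z, hAz, hzq, hzy⟩ : ∃ z, (∀ a ∈ X.carrier, a ≤ q → a < z) ∧ z ≤ q ∧
      lam.toFun z < lam.toFun y := by
    rcases (X.carrier.filter fun a => a ≤ q).eq_empty_or_nonempty with h0 | h0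
    · exact ⟨s, fun a ha haq => absurd (Finset.mem_filter.2 ⟨ha, haq⟩)
        (h0 ▸ Finset.notMem_empty a), hs, hsx y hyq⟩
    · obtain ⟨x', hx', hmax⟩ := Finset.exists_maximal h0
      obtain ⟨hx'X, hx'q⟩ := Finset.mem_filter.1 hx'
      obtain ⟨z, h1, h2, h3⟩ := hq y hyq x' (hAy x' hx'X hx'q) hx'q
      refine ⟨z, fun a ha haq => ?_, h2, h3⟩
      rcases X.isChain.total ha hx'X with h4 | h4
      · exact h4.trans_lt h1
      · exact (hmax (Finset.mem_filter.2 ⟨ha, haq⟩) h4).trans_lt h1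
  let Z : Ch S := ⟨insert q (insert z (X.carrier.filter fun a => a ≤ q)), by
    rw [Finset.coe_insert, Finset.coe_insert]
    refine IsChain.insert (IsChain.insert (X.isChain.mono
      (Finset.coe_subset.2 (Finset.filter_subset _ _))) fun b hb _ => ?_)
      fun b hb _ => ?_
    · obtain ⟨hb, hbq⟩ := Finset.mem_filter.1 hb
      exact Or.inr (hAz b hb hbq).le
    · rcases hb with rfl | hb
      · exact Or.inr hzq
      · exact Or.inr (Finset.mem_filter.1 hb).2⟩
  have hZ : IsGreatest (Z.carrier : Set S) q := by
    refine ⟨by simp [Z], fun a ha => ?_⟩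
    rcases Finset.mem_insert.1 ha with rfl | ha
    · exact le_rfl
    rcases Finset.mem_insert.1 ha with rfl | ha
    · exact hzq
    · exact (Finset.mem_filter.1 ha).2
  refine le_trans ?_ (lam.map_le_chainLength Z hZ)
  rw [← h, Ch.le_iff_forall]
  intro t ht ht'
  obtain ⟨a, ha, rfl⟩ := lam.mem_map.1 ht
  have haq : ¬ a ≤ q := fun haq => ht' (lam.mem_map.2
    ⟨a, Finset.mem_insert_of_mem (Finset.mem_insert_of_mem (Finset.mem_filter.2 ⟨ha, haq⟩)), rfl⟩)
  -- `λ(z)` is a new value: it lies above those of the members `≤ q` and below those from `y` on.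
  refine ⟨lam.toFun z, lam.mem_map.2
    ⟨z, Finset.mem_insert_of_mem (Finset.mem_insert_self _ _), rfl⟩, ?_,
    hzy.le.trans (lam.monotone (hBy a ha haq))⟩
  rw [mem_map]
  rintro ⟨c, hc, hcz⟩
  by_cases hcq : c ≤ q
  · exact (lam.strictMono (hAz c hc hcq)).ne hcz
  · exact (hzy.trans_le (lam.monotone (hBy c hc hcq))).ne' hcz

end PosetLengthFunction

end GabrielRoiter

namespace GabrielRoiter

variable {C : Type u} [Category.{v} C] [Abelian C]

/-! ### Length functions with prescribed weights of simple objects -/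

/-- `X` has a finite filtration by simple objects whose weights add up to `r`. -/
inductive WeightFiltered (wt : C → ℕ) : C → ℕ → Prop
  | zero (X : C) (hX : IsZero X) : WeightFiltered wt X 0
  | step (X' X S : C) (n : ℕ) (f : X' ⟶ X) (g : X ⟶ S) (hfg : f ≫ g = 0)
      (h : (ShortComplex.mk f g hfg).ShortExact) (hS : Simple S)
      (hX' : WeightFiltered wt X' n) : WeightFiltered wt X (n + wt S)

theorem SimpleFiltered.weightFiltered (wt : C → ℕ) {X : C} {n : ℕ} (h : SimpleFiltered X n) :
    ∃ r, WeightFiltered wt X r := by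
  induction h with
  | zero X hX => exact ⟨0, .zero X hX⟩
  | step X' X S n f g hfg h hS _ ih =>
    obtain ⟨r, hr⟩ := ih
    exact ⟨_, .step X' X S r f g hfg h hS hr⟩

/-- Restricting `X → B` to the preimage of a subobject of `B`. -/
theorem exists_shortExact_preimage {A X B X' B' S : C} {f : A ⟶ X} {p : X ⟶ B} {hfp : f ≫ p = 0}
    (h : (ShortComplex.mk f p hfp).ShortExact) {i : B' ⟶ B} {q : B ⟶ S} {hiq : i ≫ q = 0}
    (hB : (ShortComplex.mk i q hiq).ShortExact) {j : X' ⟶ X} {hj : j ≫ p ≫ q = 0}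
    (hX : (ShortComplex.mk j (p ≫ q) hj).ShortExact) :
    ∃ (f' : A ⟶ X') (p' : X' ⟶ B') (h' : f' ≫ p' = 0), (ShortComplex.mk f' p' h').ShortExact := by
  have hf : Mono f := h.mono_f
  have hp : Epi p := h.epi_g
  have hi : Mono i := hB.mono_f
  have hjm : Mono j := hX.mono_f
  let f' : A ⟶ X' := hX.exact.lift f (by simp [reassoc_of% hfp])
  have hf' : f' ≫ j = f := hX.exact.lift_f _ _
  let p' : X' ⟶ B' := hB.exact.lift (j ≫ p) (by simpa using hj)
  have hp' : p' ≫ i = j ≫ p := hB.exact.lift_f _ _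
  have h0 : f' ≫ p' = 0 := by
    rw [← cancel_mono i, Category.assoc, hp', reassoc_of% hf', hfp, zero_comp]
  refine ⟨f', p', h0, { exact := ?_, mono_f := ?_, epi_g := ?_ }⟩
  · rw [ShortComplex.exact_iff_exact_up_to_refinements]
    intro W x hx
    dsimp at x hx
    have hx0 : (x ≫ j) ≫ p = 0 := by
      rw [Category.assoc, ← hp', reassoc_of% hx, zero_comp]
    refine ⟨W, 𝟙 W, inferInstance, h.exact.lift (x ≫ j) hx0, ?_⟩
    have h1 : h.exact.lift (x ≫ j) hx0 ≫ f = x ≫ j := h.exact.lift_f _ _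
    dsimp
    rw [← cancel_mono j, Category.assoc, Category.assoc, hf', h1, Category.id_comp]
  · have : Mono (f' ≫ j) := by rwa [hf']
    exact mono_of_mono f' j
  · dsimp
    rw [epi_iff_surjective_up_to_refinements]
    intro W b
    obtain ⟨W', π, hπ, x, hx⟩ := surjective_up_to_refinements_of_epi p (b ≫ i)
    have hx0 : x ≫ p ≫ q = 0 := by
      rw [← reassoc_of% hx, hiq, comp_zero, comp_zero]
    refine ⟨W', π, hπ, hX.exact.lift x hx0, ?_⟩
    have h1 : hX.exact.lift x hx0 ≫ j = x := hX.exact.lift_f _ _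
    rw [← cancel_mono i, Category.assoc, Category.assoc, hp', reassoc_of% h1, hx]

/-- Restricting `X → B` to a subobject of `X` which together with the kernel spans `X`. -/
theorem shortExact_restrictKernel {A X B X' S : C} {f : A ⟶ X} {p : X ⟶ B} {hfp : f ≫ p = 0}
    (h : (ShortComplex.mk f p hfp).ShortExact) {j : X' ⟶ X} {g : X ⟶ S} {hjg : j ≫ g = 0}
    (hX : (ShortComplex.mk j g hjg).ShortExact) [Epi (f ≫ g)] :
    ∃ h' : restrictKernel hX f ≫ j ≫ p = 0,
      (ShortComplex.mk (restrictKernel hX f) (j ≫ p) h').ShortExact := by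
  have hf : Mono f := h.mono_f
  have hp : Epi p := h.epi_g
  have hjm : Mono j := hX.mono_f
  have hr := restrictKernel_comp hX f
  have h0 : restrictKernel hX f ≫ j ≫ p = 0 := by
    rw [reassoc_of% hr, hfp, comp_zero]
  refine ⟨h0, { exact := ?_, mono_f := ?_, epi_g := ?_ }⟩
  · rw [ShortComplex.exact_iff_exact_up_to_refinements]
    intro W x hx
    dsimp at x hx
    have hx0 : (x ≫ j) ≫ p = 0 := by simpa using hx
    have h1 : h.exact.lift (x ≫ j) hx0 ≫ f = x ≫ j := h.exact.lift_f _ _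
    refine ⟨W, 𝟙 W, inferInstance, kernel.lift (f ≫ g) (h.exact.lift (x ≫ j) hx0) ?_, ?_⟩
    · rw [reassoc_of% h1, hjg, comp_zero]
    · dsimp
      rw [← cancel_mono j, Category.assoc, Category.assoc, hr, kernel.lift_ι_assoc, h1,
        Category.id_comp]
  · exact mono_restrictKernel hX f
  · dsimp
    rw [epi_iff_surjective_up_to_refinements]
    intro W b
    obtain ⟨W₁, π₁, hπ₁, x, hx⟩ := surjective_up_to_refinements_of_epi p b
    obtain ⟨W₂, π₂, hπ₂, a, ha⟩ := surjective_up_to_refinements_of_epi (f ≫ g) (x ≫ g)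
    have hx0 : (π₂ ≫ x - a ≫ f) ≫ g = 0 := by
      rw [Preadditive.sub_comp, Category.assoc, Category.assoc, ha, sub_self]
    refine ⟨W₂, π₂ ≫ π₁, inferInstance, hX.exact.lift _ hx0, ?_⟩
    have h1 : hX.exact.lift _ hx0 ≫ j = π₂ ≫ x - a ≫ f := hX.exact.lift_f _ _
    rw [reassoc_of% h1, Preadditive.sub_comp, Category.assoc, Category.assoc, Category.assoc, hfp,
      comp_zero, sub_zero, hx]

namespace WeightFiltered

variable {wt : C → ℕ}

theorem of_iso {X Y : C} (e : X ≅ Y) {n : ℕ} (h : WeightFiltered wt X n) :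
    WeightFiltered wt Y n := by
  cases h with
  | zero _ hX => exact .zero _ (hX.of_iso e.symm)
  | step X' _ S n f g hfg h hS hX' =>
    refine .step X' Y S n (f ≫ e.hom) (e.inv ≫ g) (by simp [hfg]) ?_ hS hX'
    exact ShortComplex.shortExact_of_iso
      (S₁ := ShortComplex.mk f g hfg)
      (S₂ := ShortComplex.mk (f ≫ e.hom) (e.inv ≫ g) (by simp [hfg]))
      (ShortComplex.isoMk (Iso.refl _) e (Iso.refl _) (by simp) (by simp)) h

/-- Pull a filtration of `B` back along `p` and stack it on one of `A`. -/
theorem extension {B : C} {b : ℕ} (hB : WeightFiltered wt B b) :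
    ∀ {A X : C} {a : ℕ} {f : A ⟶ X} {p : X ⟶ B} {hfp : f ≫ p = 0},
      (ShortComplex.mk f p hfp).ShortExact → WeightFiltered wt A a →
        WeightFiltered wt X (a + b) := by
  induction hB with
  | zero B hB =>
    intro A X a f p hfp h hA
    have := h.mono_f
    have hep : Epi f := h.exact.epi_f (hB.eq_of_tgt _ _)
    have : Mono f := h.mono_f
    have : IsIso f := isIso_of_mono_of_epi f
    exact hA.of_iso (asIso f)
  | step B' B S n i q hiq hBS hS _ ih =>
    intro A X a f p hfp h hA
    have : Epi p := h.epi_g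
    have : Epi q := hBS.epi_g
    have hX := shortExact_kernel (p ≫ q)
    obtain ⟨f', p', h0, h'⟩ := exists_shortExact_preimage h hBS hX
    rw [← add_assoc]
    exact .step _ X S _ _ _ _ hX hS (ih h' hA)

/-- Each simple factor `S` of `X` goes to one end: to `B` if `A → X → S` vanishes, and otherwise to
`A`, which then maps onto `S`. -/
theorem exists_add_eq {X : C} {r : ℕ} (hX : WeightFiltered wt X r) :
    ∀ {A B : C} {f : A ⟶ X} {p : X ⟶ B} {hfp : f ≫ p = 0},
      (ShortComplex.mk f p hfp).ShortExact →
        ∃ a b, WeightFiltered wt A a ∧ WeightFiltered wt B b ∧ a + b = r := by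
  induction hX with
  | zero X hX =>
    intro A B f p hfp h
    have : Mono f := h.mono_f
    have : Epi p := h.epi_g
    exact ⟨0, 0, .zero A (IsZero.of_mono f hX), .zero B (IsZero.of_epi p hX), rfl⟩
  | step X' X S n j g hjg hXS hS hX' ih =>
    intro A B f p hfp h
    have : Mono f := h.mono_f
    have : Epi p := h.epi_g
    have : Epi g := hXS.epi_g
    by_cases hz : f ≫ g = 0
    · obtain ⟨q, hq⟩ : ∃ q : B ⟶ S, p ≫ q = g := ⟨h.exact.desc g hz, h.exact.g_desc _ _⟩
      have hqe : Epi (p ≫ q) := by rwa [hq]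
      have : Epi q := epi_of_epi p q
      have hBS := shortExact_kernel q
      subst hq
      obtain ⟨f', p', h0, h'⟩ := exists_shortExact_preimage h hBS hXS
      obtain ⟨a, b, ha, hb, hab⟩ := ih h'
      exact ⟨a, b + wt S, ha, .step _ B S b _ _ _ hBS hS hb, by omega⟩
    · have : Epi (f ≫ g) := epi_of_nonzero_to_simple hz
      obtain ⟨h0, h'⟩ := shortExact_restrictKernel h hXS
      obtain ⟨a, b, ha, hb, hab⟩ := ih h'
      exact ⟨a + wt S, b, .step _ A S a _ _ _ (shortExact_kernel (f ≫ g)) hS ha, hb, by omega⟩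

theorem isZero_or_pos (hwt : ∀ X, 0 < wt X) {X : C} {r : ℕ} (h : WeightFiltered wt X r) :
    IsZero X ∨ 0 < r := by
  cases h with
  | zero _ hX => exact Or.inl hX
  | step _ _ S n => exact Or.inr (by have := hwt S; omega)

end WeightFiltered

/-- The least total weight of a filtration of `X` by simple objects. -/
noncomputable def weight (wt : C → ℕ) (X : C) : ℕ := sInf {r | WeightFiltered wt X r}

theorem WeightFiltered.weight_le {wt : C → ℕ} {X : C} {r : ℕ} (h : WeightFiltered wt X r) :
    weight wt X ≤ r := Nat.sInf_le h

theorem weightFiltered_weight [IsLengthCategory C] (wt : C → ℕ) (X : C) :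
    WeightFiltered wt X (weight wt X) := by
  obtain ⟨n, hn⟩ := (IsLengthCategory.hasFiniteLength X).simpleFiltered
  exact Nat.sInf_mem (s := {r | WeightFiltered wt X r}) (hn.weightFiltered wt)

/-- The length function which counts the composition factors of `X` with positive weights. -/
noncomputable def LengthFunction.ofWeight [IsLengthCategory C] (wt : C → ℕ)
    (hwt : ∀ X, 0 < wt X) : LengthFunction C where
  toFun X := (weight wt X : ℝ)
  nonneg X := Nat.cast_nonneg _
  eq_zero_iff X := by
    rw [Nat.cast_eq_zero]
    constructor
    · intro h
      exact ((weightFiltered_weight wt X).isZero_or_pos hwt).resolve_right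
        (by rw [h]; exact lt_irrefl 0)
    · intro h
      exact Nat.le_zero.1 (WeightFiltered.zero X h).weight_le
  additive E hE := by
    rw [← Nat.cast_add, Nat.cast_inj]
    have hE' : (ShortComplex.mk E.f E.g E.zero).ShortExact := hE
    -- Taking the minimum avoids uniqueness of composition factors: minimal filtrations of the ends
    -- are stacked, and one of the middle term is cut in two.
    apply le_antisymm
    · exact ((weightFiltered_weight wt E.X₃).extension hE'
        (weightFiltered_weight wt E.X₁)).weight_le
    · obtain ⟨a, b, ha, hb, hab⟩ := (weightFiltered_weight wt E.X₂).exists_add_eq hE'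
      rw [← hab]
      exact add_le_add ha.weight_le hb.weight_le

theorem LengthFunction.lt_of_epi_of_not_mono (ℓ : LengthFunction C) {X Y : C} (f : X ⟶ Y) [Epi f]
    (hf : ¬ Mono f) : ℓ.toFun Y < ℓ.toFun X := by
  have h1 : ℓ.toFun X = ℓ.toFun (kernel f) + ℓ.toFun Y := ℓ.additive _ (shortExact_kernel f)
  have h2 : ℓ.toFun (kernel f) ≠ 0 := fun h0 =>
    hf (Preadditive.mono_of_isZero_kernel f ((ℓ.eq_zero_iff _).1 h0))
  have h3 := lt_of_le_of_ne (ℓ.nonneg (kernel f)) h2.symm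
  linarith

/-- An epimorphism that is not monic strictly lowers any length function; unit weights provide one.
-/
theorem isIso_of_epi_endo [IsLengthCategory C] {X : C} (f : X ⟶ X) [Epi f] : IsIso f := by
  have : Mono f := by
    by_contra hf
    exact lt_irrefl _
      ((LengthFunction.ofWeight (C := C) (fun _ => 1) fun _ => one_pos).lt_of_epi_of_not_mono f hf)
  exact isIso_of_mono_of_epi f

/-- There is a length function with a strict minimum, among nonzero objects, at a given simple
object. -/
theorem exists_lengthFunction_lt [IsLengthCategory C] (S : C) [Simple S] :
    ∃ ℓ : LengthFunction C, ∀ X : C, ¬ IsZero X → IsEmpty (X ≅ S) → ℓ.toFun S < ℓ.toFun X := by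
  classical
  -- With weight 1 on `S` and 2 on other simple objects, an object of total weight at most 1 is zero
  -- or isomorphic to `S`.
  let wt : C → ℕ := fun X => if Nonempty (X ≅ S) then 1 else 2
  have hwt : ∀ X, 0 < wt X := fun X => by dsimp only [wt]; split_ifs <;> simp
  refine ⟨LengthFunction.ofWeight wt hwt, fun X hX hXS => ?_⟩
  have hS : weight wt S ≤ 1 := by
    have h0 : IsZero (kernel (𝟙 S)) := isZero_kernel_of_mono _
    have h1 := WeightFiltered.step (wt := wt) _ S S 0 _ _ _ (shortExact_kernel (𝟙 S))
      inferInstance (.zero _ h0)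
    have h2 : 0 + wt S = 1 := by simp [wt, show Nonempty (S ≅ S) from ⟨Iso.refl S⟩]
    rw [h2] at h1
    exact h1.weight_le
  have key : ∀ {r}, WeightFiltered wt X r → 1 < r := by
    intro r hr
    cases hr with
    | zero _ h => exact absurd h hX
    | step X' _ T n f g hfg h hT hX' =>
      by_cases hTS : Nonempty (T ≅ S)
      · rcases hX'.isZero_or_pos hwt with h0 | h0
        · exfalso
          have : Mono g := h.exact.mono_g (h0.eq_of_src _ _)
          have : Epi g := h.epi_g
          have : IsIso g := isIso_of_mono_of_epi g
          obtain ⟨e⟩ := hTS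
          exact hXS.false (asIso g ≪≫ e)
        · have := hwt T
          omega
      · have : wt T = 2 := by simp only [wt, if_neg hTS]
        omega
  exact Nat.cast_lt.2 (hS.trans_lt (key (weightFiltered_weight wt X)))

/-! ### Composition length and indecomposable objects -/

section Indecomposables

/-- A monomorphism that splits, from a nonzero object into an indecomposable one, is an
isomorphism. -/
theorem isIso_of_retraction {A X : C} (hA : ¬ IsZero A) (hX : Indecomposable X) (f : A ⟶ X)
    (r : X ⟶ A) (hr : f ≫ r = 𝟙 A) : IsIso f := by
  have hs : IsSplitMono f := IsSplitMono.mk' ⟨r, hr⟩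
  let σ := ShortComplex.Splitting.ofExactOfRetraction _ (shortExact_cokernel f).exact r hr
    (shortExact_cokernel f).epi_g
  rcases hX.2 _ _ σ.isoBinaryBiproduct with h | h
  · exact absurd h hA
  · have : Epi f := Preadditive.epi_of_cokernel_zero (h.eq_of_tgt _ _)
    exact isIso_of_mono_of_epi f

theorem SimpleFiltered.exists_simple_mono {X : C} {n : ℕ} (h : SimpleFiltered X n)
    (hX : ¬ IsZero X) : ∃ (S : C) (f : S ⟶ X), Simple S ∧ Mono f := by
  induction h with
  | zero X h => exact absurd h hX
  | step X' X S n f g hfg h hS _ ih =>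
    by_cases h0 : IsZero X'
    · have : Mono g := h.exact.mono_g (h0.eq_of_src _ _)
      have : Epi g := h.epi_g
      have : IsIso g := isIso_of_mono_of_epi g
      exact ⟨S, inv g, hS, inferInstance⟩
    · obtain ⟨T, i, hT, hi⟩ := ih h0
      have : Mono f := h.mono_f
      exact ⟨T, i ≫ f, hT, mono_comp i f⟩

variable [IsLengthCategory C]

open Classical in
/-- The least number of steps in a filtration of `X` by simple objects. -/
noncomputable def compositionLength (X : C) : ℕ :=
  Nat.find (IsLengthCategory.hasFiniteLength X).simpleFiltered

theorem compositionLength_lt {A X : C} (i : A ⟶ X) [Mono i] (hi : ¬ IsIso i) :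
    compositionLength A < compositionLength X := by
  classical
  have h := Nat.find_spec (IsLengthCategory.hasFiniteLength X).simpleFiltered
  rcases h.isIso_or i with h1 | ⟨m, hm, hm'⟩
  · exact absurd h1 hi
  · exact (Nat.find_min' _ hm').trans_lt hm

/-- This stands in for a decomposition into indecomposables: the projections to indecomposable
summands have no common kernel. In a proper decomposition `h` is nonzero on some summand, which is
shorter than `Z`. -/
theorem exists_splitEpi_to_indecomposable {Z W : C} (h : W ⟶ Z) (hh : h ≠ 0) :
    ∃ (Y : C) (p : Z ⟶ Y), Indecomposable Y ∧ IsSplitEpi p ∧ h ≫ p ≠ 0 := by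
  induction hn : compositionLength Z using Nat.strong_induction_on generalizing Z with
  | _ n ih =>
  by_cases hZ : Indecomposable Z
  · exact ⟨Z, 𝟙 Z, hZ, inferInstance, by simpa using hh⟩
  have hZ0 : ¬ IsZero Z := fun h0 => hh (h0.eq_of_tgt _ _)
  simp only [Indecomposable, not_and, not_forall, not_or] at hZ
  obtain ⟨A, B, e, hA, hB⟩ := hZ hZ0
  have key : ∀ {D : C} (i : D ⟶ Z) (q : Z ⟶ D), i ≫ q = 𝟙 D → ¬ IsIso i → h ≫ q ≠ 0 →
      ∃ (Y : C) (p : Z ⟶ Y), Indecomposable Y ∧ IsSplitEpi p ∧ h ≫ p ≠ 0 := by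
    intro D i q hiq hi hq
    have : IsSplitMono i := IsSplitMono.mk' ⟨q, hiq⟩
    have : IsSplitEpi q := IsSplitEpi.mk' ⟨i, hiq⟩
    obtain ⟨Y, p, hY, hp, h1⟩ := ih _ (hn ▸ compositionLength_lt i hi) (h ≫ q) hq rfl
    exact ⟨Y, q ≫ p, hY, inferInstance, by simpa using h1⟩
  by_cases h1 : h ≫ e.hom ≫ biprod.fst = 0
  · by_cases h2 : h ≫ e.hom ≫ biprod.snd = 0
    · exfalso
      apply hh
      rw [← cancel_mono e.hom]
      apply biprod.hom_ext <;> simpa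
    -- If the inclusion of one summand were invertible, the projection to the other would vanish,
    -- and so would that summand.
    · refine key (biprod.inr ≫ e.inv) (e.hom ≫ biprod.snd) (by simp) (fun hi => hA ?_) h2
      have : (biprod.inr ≫ e.inv) ≫ e.hom ≫ biprod.fst = (0 : B ⟶ A) := by simp
      have h3 : e.hom ≫ biprod.fst = (0 : Z ⟶ A) := by
        rw [← cancel_epi (biprod.inr ≫ e.inv), this, comp_zero]
      rw [IsZero.iff_id_eq_zero, ← biprod.inl_fst (X := A) (Y := B),
        ← e.inv_hom_id_assoc biprod.fst, h3, comp_zero, comp_zero]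
  · refine key (biprod.inl ≫ e.inv) (e.hom ≫ biprod.fst) (by simp) (fun hi => hB ?_) h1
    have : (biprod.inl ≫ e.inv) ≫ e.hom ≫ biprod.snd = (0 : A ⟶ B) := by simp
    have h3 : e.hom ≫ biprod.snd = (0 : Z ⟶ B) := by
      rw [← cancel_epi (biprod.inl ≫ e.inv), this, comp_zero]
    rw [IsZero.iff_id_eq_zero, ← biprod.inr_snd (X := A) (Y := B),
      ← e.inv_hom_id_assoc biprod.snd, h3, comp_zero, comp_zero]

/-- Fitting's lemma. -/
theorem isIso_or_pow_eq_zero {X : C} (hX : Indecomposable X) (e : End X) :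
    IsIso (e : X ⟶ X) ∨ ∃ n : ℕ, e ^ (n + 1) = 0 := by
  classical
  -- Among the epi-mono factorizations of positive powers of `e`, choose one through an object of
  -- least length; writing `n + 1` excludes the identity.
  have hex : ∃ m, ∃ (n : ℕ) (K : C) (π : X ⟶ K) (ι : K ⟶ X), Epi π ∧ Mono ι ∧
      (e ^ (n + 1) : End X) = π ≫ ι ∧ compositionLength K = m :=
    ⟨_, 0, _, factorThruImage (e : X ⟶ X), image.ι (e : X ⟶ X), inferInstance, inferInstance,
      by simp, rfl⟩
  obtain ⟨n, K, π, ι, hπ, hι, hfac, hK⟩ := Nat.find_spec hex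
  -- Otherwise the square of `e ^ (n + 1)`, whose exponent is `(2 * n + 1) + 1`, factors through the
  -- shorter image of `ι ≫ π`.
  have hθ : Epi (ι ≫ π) := by
    by_contra hne
    have hni : ¬ IsIso (image.ι (ι ≫ π)) := fun hi => hne <| by
      rw [← image.fac (ι ≫ π)]
      exact epi_comp _ _
    refine Nat.find_min hex (hK ▸ compositionLength_lt _ hni) ⟨2 * n + 1, _,
      π ≫ factorThruImage (ι ≫ π), image.ι (ι ≫ π) ≫ ι, epi_comp _ _, mono_comp _ _, ?_, rfl⟩
    have h2 : e ^ (2 * n + 1 + 1) = e ^ (n + 1) * e ^ (n + 1) := by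
      rw [← pow_add]; congr 1; omega
    rw [h2, End.mul_def, hfac]
    have h3 := image.fac (ι ≫ π)
    simp only [Category.assoc, reassoc_of% h3]
  have : IsIso (ι ≫ π) := isIso_of_epi_endo _
  by_cases hK0 : IsZero K
  · right
    exact ⟨n, by rw [hfac, hK0.eq_of_tgt π 0, zero_comp]⟩
  · left
    have hi : IsIso ι := isIso_of_retraction hK0 hX ι (π ≫ inv (ι ≫ π))
      (by rw [← Category.assoc, IsIso.hom_inv_id])
    have hp : IsIso π := by
      have : π = inv ι ≫ (ι ≫ π) := by simp
      rw [this]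
      infer_instance
    have hm : Mono (e ≫ (e ^ n : End X) : X ⟶ X) := by
      have : (e ≫ (e ^ n : End X) : X ⟶ X) = π ≫ ι := by rw [← hfac, pow_succ, End.mul_def]
      rw [this]
      infer_instance
    have : Mono (e : X ⟶ X) := mono_of_mono (e : X ⟶ X) (e ^ n : End X)
    exact isIso_of_mono_endo _

end Indecomposables

end GabrielRoiter

/-! ### Injective indecomposables and maximal measure -/

namespace GabrielRoiter

variable {C : Type u} [Category.{v} C] [Abelian C] [IsLengthCategory C]

/-- Nonzero subobjects of an indecomposable injective object are indecomposable. -/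
theorem indecomposable_of_mono {Z Q : C} (hQ : Indecomposable Q) [Injective Q] (i : Z ⟶ Q)
    [Mono i] (hZ : ¬ IsZero Z) : Indecomposable Z := by
  refine ⟨hZ, fun A B φ => ?_⟩
  let p : Z ⟶ Z := φ.hom ≫ biprod.fst ≫ biprod.inl ≫ φ.inv
  have hpp : p ≫ p = p := by simp [p]
  -- Extend the projection `p` onto `A` to `Q` and apply Fitting's lemma: if `e` is invertible, `p`
  -- is monic and `B` vanishes; if `e` is nilpotent, `p = 0` and `A` vanishes.
  let e : End Q := Injective.factorThru (p ≫ i) i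
  have he : i ≫ (e : Q ⟶ Q) = p ≫ i := Injective.comp_factorThru _ _
  rcases isIso_or_pow_eq_zero hQ e with h | ⟨n, hn⟩
  · right
    have hm : Mono (p ≫ i) := by
      rw [← he]
      exact mono_comp i _
    have hpm : Mono p := mono_of_mono p i
    have h0 : (biprod.inr ≫ φ.inv : B ⟶ Z) = 0 := by
      rw [← cancel_mono p]
      simp [p]
    rw [IsZero.iff_id_eq_zero]
    calc 𝟙 B = (biprod.inr ≫ φ.inv) ≫ φ.hom ≫ biprod.snd := by simp
      _ = 0 := by rw [h0, zero_comp]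
  · left
    have key : ∀ n : ℕ, i ≫ (e ^ (n + 1) : End Q) = p ≫ i := by
      intro n
      induction n with
      | zero => simpa using he
      | succ n ih =>
        rw [pow_succ, End.mul_def, reassoc_of% he, ih, reassoc_of% hpp]
    have h0 : p = 0 := by
      rw [← cancel_mono i, ← key n, hn, zero_comp, comp_zero]
    rw [IsZero.iff_id_eq_zero]
    calc 𝟙 A = (biprod.inl ≫ φ.inv) ≫ p ≫ φ.hom ≫ biprod.fst := by simp [p]
      _ = 0 := by rw [h0, zero_comp, comp_zero]

theorem Ind.mk_lt_mk_of_mono {X Y : C} {hX : Indecomposable X} {hY : Indecomposable Y}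
    (f : X ⟶ Y) [Mono f] (hf : ¬ IsIso f) : Ind.mk X hX < Ind.mk Y hY := by
  refine lt_of_le_of_ne (Ind.mk_le_mk.2 ⟨f, inferInstance⟩) fun h => ?_
  obtain ⟨e⟩ := Ind.mk_eq_mk.1 h
  have h1 : IsIso (f ≫ e.inv) := isIso_of_mono_endo _
  exact hf (IsIso.of_isIso_comp_right f e.inv)

/-- Injective indecomposable objects have maximal measure with respect to some length function. -/
theorem exists_gabrielRoiterMeasure_le {Q : C} (hQ : Indecomposable Q) [Injective Q] :
    ∃ ℓ : LengthFunction C, ∀ x : Ind C,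
      ℓ.gabrielRoiterMeasure x ≤ ℓ.gabrielRoiterMeasure (Ind.mk Q hQ) := by
  obtain ⟨n, hn⟩ := (IsLengthCategory.hasFiniteLength Q).simpleFiltered
  obtain ⟨S, s, hS, hs⟩ := hn.exists_simple_mono hQ.1
  obtain ⟨ℓ, hℓ⟩ := exists_lengthFunction_lt S
  -- `S` handles chains with no member embedding in `Q`.
  refine ⟨ℓ, fun x => ℓ.onInd.chainLength_le_of_interpolation
    (s := Ind.mk S (indecomposable_of_simple S)) (Ind.mk_le_mk.2 ⟨s, hs⟩) ?_ ?_ x⟩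
  · intro x hx
    obtain ⟨X, hX, rfl⟩ := Ind.exists_mk x
    exact hℓ X hX.1 ⟨fun e => hx (Ind.mk_le_mk.2 ⟨e.hom ≫ s, mono_comp _ _⟩)⟩
  · intro y hy x hxy hx
    obtain ⟨X, hX, rfl⟩ := Ind.exists_mk x
    obtain ⟨Y, hY, rfl⟩ := Ind.exists_mk y
    obtain ⟨m, hm⟩ := Ind.mk_le_mk.1 hx
    obtain ⟨g, hg⟩ := Ind.mk_le_mk.1 hxy.le
    -- The image of `φ` interpolates: it contains `X`, and it is shorter than `Y` because `Y` does
    -- not embed in `Q`.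
    let φ : Y ⟶ Q := Injective.factorThru m g
    have hφ : g ≫ φ = m := Injective.comp_factorThru _ _
    have hgm : Mono (g ≫ factorThruImage φ) := by
      have : Mono ((g ≫ factorThruImage φ) ≫ image.ι φ) := by
        rwa [Category.assoc, image.fac, hφ]
      exact mono_of_mono _ (image.ι φ)
    have hZ : ¬ IsZero (image φ) := fun h0 => hX.1 (IsZero.of_mono (g ≫ factorThruImage φ) h0)
    refine ⟨Ind.mk (image φ) (indecomposable_of_mono hQ (image.ι φ) hZ),
      Ind.mk_lt_mk_of_mono (g ≫ factorThruImage φ) fun hi => ?_,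
      Ind.mk_le_mk.2 ⟨image.ι φ, inferInstance⟩,
      ℓ.lt_of_epi_of_not_mono (factorThruImage φ) fun hm' => ?_⟩
    -- If `X → image φ` were invertible, `g` would split.
    · have := isIso_of_retraction hX.1 hY g
        (factorThruImage φ ≫ inv (g ≫ factorThruImage φ))
        (by rw [← Category.assoc, IsIso.hom_inv_id])
      exact hxy.ne (Ind.mk_eq_mk.2 ⟨asIso g⟩)
    · refine hy (Ind.mk_le_mk.2 ⟨φ, ?_⟩)
      rw [← image.fac φ]
      exact mono_comp _ _

/-! ### Gabriel's main property -/

/-- The common kernel of the morphisms in `P` is zero. -/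
def JointlyMono {X : C} (P : ∀ Y : C, (X ⟶ Y) → Prop) : Prop :=
  ∀ ⦃W : C⦄ (h : W ⟶ X), (∀ (Y : C) (f : X ⟶ Y), P Y f → h ≫ f = 0) → h = 0

/-- Gabriel's main property for `X`: among jointly monic morphisms from `X` to indecomposable
objects there is an isomorphism, or one whose target has larger measure than `X`. -/
def MainProperty (ℓ : LengthFunction C) (X : C) (hX : Indecomposable X) : Prop :=
  ∀ P : (∀ Y : C, (X ⟶ Y) → Prop), JointlyMono P → (∀ Y f, P Y f → Indecomposable Y) →
    ∃ (Y : C) (hY : Indecomposable Y) (f : X ⟶ Y), P Y f ∧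
      (IsIso f ∨ ℓ.gabrielRoiterMeasure (Ind.mk X hX) < ℓ.gabrielRoiterMeasure (Ind.mk Y hY))

variable (ℓ : LengthFunction C)

/-- If none of the epimorphisms is invertible, all targets are shorter than `X`. By
`chainLength_lt_of_or`, either any such target beats `X`, or it suffices to beat some `X'` properly
below `X`. The family restricted to `X'` is still jointly monic, and an isomorphism among the
restrictions would split `X' → X`. -/
theorem exists_isIso_or_lt_of_epi {X : C} (hX : Indecomposable X)
    (ih : ∀ (X' : C) (hX' : Indecomposable X') (g : X' ⟶ X), Mono g → ¬ IsIso g →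
      MainProperty ℓ X' hX')
    (P : ∀ Y : C, (X ⟶ Y) → Prop) (hP : JointlyMono P)
    (hPi : ∀ Y f, P Y f → Indecomposable Y) (hPe : ∀ Y f, P Y f → Epi f) :
    ∃ (Y : C) (hY : Indecomposable Y) (f : X ⟶ Y), P Y f ∧
      (IsIso f ∨ ℓ.gabrielRoiterMeasure (Ind.mk X hX) < ℓ.gabrielRoiterMeasure (Ind.mk Y hY)) := by
  by_cases hm : ∃ (Y : C) (f : X ⟶ Y), P Y f ∧ Mono f
  · obtain ⟨Y, f, hf, _⟩ := hm
    have := hPe Y f hf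
    exact ⟨Y, hPi Y f hf, f, hf, Or.inl (isIso_of_mono_of_epi f)⟩
  have hlt : ∀ Y f, P Y f → ℓ.toFun Y < ℓ.toFun X := fun Y f hf => by
    have := hPe Y f hf
    exact ℓ.lt_of_epi_of_not_mono f fun h => hm ⟨Y, f, hf, h⟩
  rcases ℓ.onInd.chainLength_lt_of_or (Ind.mk X hX) with h | ⟨x', hx', h⟩
  · obtain ⟨Y, f, hf⟩ : ∃ Y f, P Y f := by
      by_contra hne
      exact hX.1 ((IsZero.iff_id_eq_zero X).2
        (hP (𝟙 X) fun Y f hf => absurd ⟨Y, f, hf⟩ hne))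
    exact ⟨Y, hPi Y f hf, f, hf, Or.inr (h _ (hlt Y f hf))⟩
  · obtain ⟨X', hX', rfl⟩ := Ind.exists_mk x'
    obtain ⟨g, hg⟩ := Ind.mk_le_mk.1 hx'.le
    have hgi : ¬ IsIso g := fun _ => hx'.ne (Ind.mk_eq_mk.2 ⟨asIso g⟩)
    obtain ⟨Y, hY, _, ⟨f, hf, rfl⟩, hfY⟩ := ih X' hX' g hg hgi
      (fun Y k => ∃ f, P Y f ∧ k = g ≫ f) (fun W k hk => by
        have hkg : k ≫ g = 0 := hP _ fun Y f hf => by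
          rw [Category.assoc]
          exact hk Y _ ⟨f, hf, rfl⟩
        rwa [← cancel_mono g, zero_comp])
      (fun Y k ⟨f, hf, _⟩ => hPi Y f hf)
    rcases hfY with hi | hlt'
    · exact absurd (isIso_of_retraction hX'.1 hX g (f ≫ inv (g ≫ f))
        (by rw [← Category.assoc, IsIso.hom_inv_id])) hgi
    · exact ⟨Y, hY, f, hf, Or.inr (h _ (hlt Y f hf) hlt')⟩

/-- Reduce to epimorphisms by following the projection of each `f` onto its image with projections
to indecomposable summands. Such a summand embeds in the target of `f`, so its measure is at most
that of the target. -/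
theorem mainProperty (X : C) (hX : Indecomposable X) : MainProperty ℓ X hX := by
  induction hn : compositionLength X using Nat.strong_induction_on generalizing X with
  | _ n ih =>
  intro P hP hPi
  obtain ⟨Z, hZ, k, ⟨Y, f, p, hf, ⟨_, hp⟩, rfl⟩, hk⟩ := exists_isIso_or_lt_of_epi ℓ hX
    (fun X' hX' g hg hgi => ih _ (hn ▸ compositionLength_lt g hgi) X' hX' rfl)
    (fun Z k => ∃ (Y : C) (f : X ⟶ Y) (p : image f ⟶ Z), P Y f ∧
      (Indecomposable Z ∧ IsSplitEpi p) ∧ k = factorThruImage f ≫ p)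
    (fun W h hh => hP h fun Y f hf => by
      by_contra h0
      have h1 : h ≫ factorThruImage f ≠ 0 := fun h1 => h0 <| by
        rw [← image.fac f, reassoc_of% h1, zero_comp]
      obtain ⟨Z, p, hZ, hp, h2⟩ := exists_splitEpi_to_indecomposable _ h1
      exact h2 (by simpa using hh Z _ ⟨Y, f, p, hf, ⟨hZ, hp⟩, rfl⟩))
    (fun Z k ⟨_, _, _, _, hZ, _⟩ => hZ.1)
    (fun Z k ⟨_, f, p, _, ⟨_, hp⟩, hk⟩ => by
      rw [hk]
      exact epi_comp _ _)
  have hY := hPi Y f hf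
  refine ⟨Y, hY, f, hf, ?_⟩
  rcases hk with hk | hk
  · have hfm : Mono f := by
      have : Mono (factorThruImage f) := mono_of_mono _ p
      rw [← image.fac f]
      exact mono_comp _ _
    by_cases hfi : IsIso f
    · exact Or.inl hfi
    · exact Or.inr (ℓ.onInd.chainLength_strictMono (Ind.mk_lt_mk_of_mono f hfi))
  · exact Or.inr (hk.trans_le (ℓ.onInd.chainLength_strictMono.monotone
      (Ind.mk_le_mk.2 ⟨section_ p ≫ image.ι f, mono_comp _ _⟩)))

/-- An indecomposable object of maximal measure is injective. -/
theorem injective_of_gabrielRoiterMeasure_le {Q : C} (hQ : Indecomposable Q)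
    (h : ∀ (X : C) (hX : Indecomposable X),
      ℓ.gabrielRoiterMeasure (Ind.mk X hX) ≤ ℓ.gabrielRoiterMeasure (Ind.mk Q hQ)) :
    Injective Q := by
  -- Apply the main property to all `i ≫ p` with `p` from `Y` to an indecomposable; maximality rules
  -- out a larger measure, so some `i ≫ p` is invertible.
  have hsplit : ∀ {Y : C} (i : Q ⟶ Y) [Mono i], ∃ r : Y ⟶ Q, i ≫ r = 𝟙 Q := by
    intro Y i _
    obtain ⟨Z, hZ, _, ⟨p, _, rfl⟩, hp⟩ := mainProperty ℓ Q hQ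
      (fun Z k => ∃ p : Y ⟶ Z, Indecomposable Z ∧ k = i ≫ p)
      (fun W k hk => by
        by_contra h0
        have h1 : k ≫ i ≠ 0 := fun h1 => h0 (by rwa [← cancel_mono i, zero_comp])
        obtain ⟨Z, p, hZ, _, h2⟩ := exists_splitEpi_to_indecomposable _ h1
        exact h2 (by simpa using hk Z _ ⟨p, hZ, rfl⟩))
      (fun Z k ⟨_, hZ, _⟩ => hZ)
    rcases hp with hp | hp
    · exact ⟨p ≫ inv (i ≫ p), by rw [← Category.assoc, IsIso.hom_inv_id]⟩
    · exact absurd hp (h Z hZ).not_gt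
  refine ⟨fun {A B} g f hf => ?_⟩
  -- The pushout of the monomorphism `f` along `g` contains `Q`; a retraction onto `Q` extends `g`
  -- to `B`.
  obtain ⟨r, hr⟩ := hsplit (pushout.inr f g)
  exact ⟨pushout.inl f g ≫ r, by rw [pushout.condition_assoc, hr, Category.comp_id]⟩

end GabrielRoiter

theorem mainTheorem4 {C : Type u} [Category.{v} C] [Abelian C]
    [GabrielRoiter.IsLengthCategory C] (Q : C) (hQ : Indecomposable Q) :
    Injective Q ↔
      ∃ ℓ : GabrielRoiter.LengthFunction C, ∀ (X : C) (hX : Indecomposable X),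
        ℓ.gabrielRoiterMeasure (GabrielRoiter.Ind.mk X hX) ≤
          ℓ.gabrielRoiterMeasure (GabrielRoiter.Ind.mk Q hQ) := by
  constructor
  · intro _
    obtain ⟨ℓ, h⟩ := GabrielRoiter.exists_gabrielRoiterMeasure_le hQ
    exact ⟨ℓ, fun X hX => h _⟩
  · rintro ⟨ℓ, h⟩
    exact GabrielRoiter.injective_of_gabrielRoiterMeasure_le ℓ hQ h
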